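/- All graphs are finite and simple. A graph is a unit interval graph if its vertices can be put in one-to-one correspondence with closed intervals of unit length in $\mathbb{R}$ so that two different vertices are adjacent if and only if their intervals intersect. A unit interval order of $G$ is an enumeration $v_1,\dots,v_n$ of $V(G)$ such that the closed neighborhood of every vertex consists of consecutive vertices. A graph is $2$-connected if it has at least three vertices, is connected, and remains connected after the deletion of any one vertex. A set $S\subseteq V(G)$ is $P_3$-convex if every vertex outside $S$ has at most one neighbor in $S$, and $R\subseteq V(G)$ is a ($P_3$-)hull set of $G$ if the smallest $P_3$-convex set containing $R$ is $V(G)$. For a hull set $R$ let $R_0=R$ and let $R_{i+1}$ be obtained from $R_i$ by adding all vertices with at least two neighbors in $R_i$; let $\tau_R(G)$ be the least $t$ with $R_t=V(G)$, and let $\tau(G)=\max\{\tau_R(G): R \text{ is a hull set of } G\}$ be the percolation time of $G$. Theorem. Let $G$ be a $2$-connected unit interval graph with $|V(G)|=n\ge 3$. Then there exists a $2$-connected unit interval graph $G^*$ such that any two distinct maximal cliques of $G^*$ with nonempty intersection have at least two common vertices, and $$\tau(G)=\tau(G^*)=\mathrm{diam}(G^*).$$ Moreover, for every unit interval order $v_1,\dots,v_n$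 of $G$, the sets $\{v_1,v_2\}$ and $\{v_{n-1},v_n\}$ are hull sets of $G$ and $$\tau(G)=\tau_{\{v_1,v_2\}}(G)=\tau_{\{v_{n-1},v_n\}}(G).$$ -/

import Mathlib

namespace P3Perc

variable {V : Type*}

/-- `G` is a unit interval graph: its vertices are in one-to-one correspondence with closed
intervals `[f v, f v + 1]` of the real line so that two different vertices are adjacent if and
only if their intervals intersect. -/
def IsUnitIntervalGraph (G : SimpleGraph V) : Prop :=
  ∃ f : V → ℝ, Function.Injective f ∧ ∀ u v : V, u ≠ v →
    (G.Adj u v ↔ (Set.Icc (f u) (f u + 1) ∩ Set.Icc (f v) (f v + 1)).Nonempty)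

/-- The enumeration `v 0, v 1, …, v (n - 1)` of the vertices of `G` is a unit interval order:
the closed neighborhood of each vertex consists of consecutive vertices. -/
def IsUnitIntervalOrder (G : SimpleGraph V) {n : ℕ} (v : Fin n ≃ V) : Prop :=
  ∀ i : Fin n, {j : Fin n | j = i ∨ G.Adj (v i) (v j)}.OrdConnected

/-- `G` is `2`-connected: it has at least three vertices, it is connected, and it remains
connected when any single vertex is deleted. -/
def IsTwoConnected [Fintype V] (G : SimpleGraph V) : Prop :=
  3 ≤ Fintype.card V ∧ G.Connected ∧ ∀ v : V, (G.induce ({v}ᶜ : Set V)).Connected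

/-- Any two distinct maximal cliques with nonempty intersection share at least two vertices. -/
def MaximalCliquesShareTwo (G : SimpleGraph V) : Prop :=
  ∀ C D : Set V, Maximal G.IsClique C → Maximal G.IsClique D → C ≠ D →
    (C ∩ D).Nonempty → 2 ≤ (C ∩ D).ncard

/-- `S` is `P₃`-convex: each vertex outside `S` has at most one neighbor in `S`. -/
def IsP3Convex (G : SimpleGraph V) (S : Set V) : Prop :=
  ∀ v, v ∉ S → (G.neighborSet v ∩ S).ncard ≤ 1

/-- The `P₃`-hull of `R`: the smallest `P₃`-convex set containing `R`. -/
def p3Hull (G : SimpleGraph V) (R : Set V) : Set V :=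
  ⋂₀ {S | IsP3Convex G S ∧ R ⊆ S}

/-- `R` is a `P₃`-hull set of `G` (`R` percolates `G`). -/
def IsHullSet (G : SimpleGraph V) (R : Set V) : Prop :=
  p3Hull G R = Set.univ

/-- One round of percolation: add all vertices with at least two neighbors in `S`. -/
def percStep (G : SimpleGraph V) (S : Set V) : Set V :=
  S ∪ {v | 2 ≤ (G.neighborSet v ∩ S).ncard}

/-- The set reached from `R` after `t` rounds of percolation. -/
def percSet (G : SimpleGraph V) (R : Set V) (t : ℕ) : Set V :=
  (percStep G)^[t] R

/-- `τ_R(G)`: the least number of rounds after which `R` has reached every vertex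
(only meaningful for hull sets `R`). -/
noncomputable def percTimeOf (G : SimpleGraph V) (R : Set V) : ℕ :=
  sInf {t | percSet G R t = Set.univ}

/-- The percolation time `τ(G)`: the maximum of `τ_R(G)` over all hull sets `R` of `G`. -/
noncomputable def percTime (G : SimpleGraph V) : ℕ :=
  sSup {t | ∃ R : Set V, IsHullSet G R ∧ percTimeOf G R = t}

/-- Being a hull set is the same as reaching all vertices after finitely many rounds. -/
theorem isHullSet_iff [Finite V] (G : SimpleGraph V) (R : Set V) :
    IsHullSet G R ↔ ∃ t, percSet G R t = Set.univ := by
  have hmono : Monotone (percSet G R) := by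
    refine monotone_nat_of_le_succ fun t => ?_
    rw [percSet, percSet, Function.iterate_succ_apply']
    exact Set.subset_union_left
  constructor
  · intro h
    obtain ⟨N, hN⟩ := WellFoundedGT.monotone_chain_condition
      (⟨percSet G R, hmono⟩ : ℕ →o Set V)
    refine ⟨N, ?_⟩
    have h1 : percSet G R N = percSet G R (N + 1) := hN (N + 1) (Nat.le_succ N)
    rw [percSet, percSet, Function.iterate_succ_apply'] at h1
    refine Set.eq_univ_of_univ_subset ?_
    rw [← h]
    refine Set.sInter_subset_of_mem ⟨fun v hv => ?_, hmono (Nat.zero_le N)⟩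
    by_contra hc
    apply hv
    rw [percSet, h1]
    exact Or.inr (Nat.lt_of_not_le hc)
  · rintro ⟨t, ht⟩
    refine Set.eq_univ_of_univ_subset ?_
    rw [← ht]
    refine Set.subset_sInter fun S hS => ?_
    clear ht
    induction t with
    | zero => exact hS.2
    | succ k ih =>
      rw [percSet, Function.iterate_succ_apply']
      rintro v (hv | hv)
      · exact ih hv
      · by_contra hc
        have h1 := hS.1 v hc
        have h2 : (G.neighborSet v ∩ percSet G R k).ncard ≤ (G.neighborSet v ∩ S).ncard :=
          Set.ncard_le_ncard (Set.inter_subset_inter_right _ ih) (Set.toFinite _)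
        have h3 : 2 ≤ (G.neighborSet v ∩ percSet G R k).ncard := hv
        omega

/-- The supremum that defines the percolation time of a finite graph is a maximum. -/
theorem percTime_isGreatest [Finite V] (G : SimpleGraph V) :
    IsGreatest {t | ∃ R : Set V, IsHullSet G R ∧ percTimeOf G R = t} (percTime G) := by
  have hne : {t | ∃ R : Set V, IsHullSet G R ∧ percTimeOf G R = t}.Nonempty :=
    ⟨_, Set.univ, (isHullSet_iff G _).2 ⟨0, rfl⟩, rfl⟩
  have hfin : {t | ∃ R : Set V, IsHullSet G R ∧ percTimeOf G R = t}.Finite :=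
    Set.Finite.subset (Set.finite_range (percTimeOf G)) (by rintro t ⟨R, -, rfl⟩; exact ⟨R, rfl⟩)
  exact ⟨Nat.sSup_mem hne hfin.bddAbove, fun t ht => le_csSup hfin.bddAbove ht⟩

end P3Perc

/-! In a unit interval order of a `2`-connected graph, vertices at distance two in the order are
adjacent, and everything is governed by the monotone last-neighbor function `r`. Percolation from
the first two vertices infects initial segments, whose ends satisfy `front (t + 1) = r (front t -
1)`: a new vertex must see the last two infected ones. A hull set other than `V` contains two
vertices with a common neighbor; within two rounds they fill an interval that has caught up with the
front, and it then stays ahead (`mem_percSet_of_le`). Reversing the order handles the left side, and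
both end pairs need equally long (`front_eq_of_percSet_eq_univ`), so either is slowest. The graph
`G*` only has to realize the number `T = percTime G`: a path on `T + 1` vertices with each vertex
doubled has diameter and percolation time `T`. -/

namespace P3Perc

/-! ### Percolation in arbitrary finite graphs -/

section Percolation

variable {V : Type*} {G : SimpleGraph V}

theorem percSet_succ (R : Set V) (t : ℕ) :
    percSet G R (t + 1) = percStep G (percSet G R t) := by
  rw [percSet, percSet, Function.iterate_succ_apply']

theorem percTimeOf_le {R : Set V} {t : ℕ} (h : percSet G R t = Set.univ) :
    percTimeOf G R ≤ t :=
  Nat.sInf_le h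

variable [Finite V]

theorem two_le_ncard_neighborSet_inter_iff {S : Set V} {z : V} :
    2 ≤ (G.neighborSet z ∩ S).ncard ↔
      ∃ x ∈ S, ∃ y ∈ S, x ≠ y ∧ G.Adj z x ∧ G.Adj z y := by
  change 1 < (G.neighborSet z ∩ S).ncard ↔ _
  rw [Set.one_lt_ncard_iff (Set.toFinite _)]
  constructor
  · rintro ⟨x, y, hx, hy, hxy⟩
    exact ⟨x, hx.2, y, hy.2, hxy, hx.1, hy.1⟩
  · rintro ⟨x, hx, y, hy, hxy, hzx, hzy⟩
    exact ⟨x, y, ⟨hzx, hx⟩, ⟨hzy, hy⟩, hxy⟩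

theorem mem_percSet_succ {R : Set V} {t : ℕ} {z : V} :
    z ∈ percSet G R (t + 1) ↔ z ∈ percSet G R t ∨
      ∃ x ∈ percSet G R t, ∃ y ∈ percSet G R t, x ≠ y ∧ G.Adj z x ∧ G.Adj z y := by
  rw [percSet_succ, percStep, Set.mem_union, Set.mem_ofPred_eq,
    two_le_ncard_neighborSet_inter_iff]

theorem percSet_mono (R : Set V) : Monotone (percSet G R) :=
  monotone_nat_of_le_succ fun _ _ hz => mem_percSet_succ.2 (Or.inl hz)

theorem mem_percSet_succ_of_adj {R : Set V} {t : ℕ} {x y z : V} (hx : x ∈ percSet G R t)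
    (hy : y ∈ percSet G R t) (hxy : x ≠ y) (hzx : z = x ∨ G.Adj z x) (hzy : z = y ∨ G.Adj z y) :
    z ∈ percSet G R (t + 1) := by
  rw [mem_percSet_succ]
  rcases hzx with rfl | hzx
  · exact Or.inl hx
  rcases hzy with rfl | hzy
  · exact Or.inl hy
  exact Or.inr ⟨x, hx, y, hy, hxy, hzx, hzy⟩

theorem IsHullSet.percSet_percTimeOf {R : Set V} (h : IsHullSet G R) :
    percSet G R (percTimeOf G R) = Set.univ :=
  Nat.sInf_mem (s := {t | percSet G R t = Set.univ}) ((isHullSet_iff G R).1 h)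

theorem percTimeOf_le_percTime {R : Set V} (h : IsHullSet G R) :
    percTimeOf G R ≤ percTime G :=
  (percTime_isGreatest G).2 ⟨R, h, rfl⟩

theorem percTime_le {T : ℕ} (h : ∀ R, IsHullSet G R → percSet G R T = Set.univ) :
    percTime G ≤ T := by
  obtain ⟨R, hR, hT⟩ := (percTime_isGreatest G).1
  exact hT ▸ percTimeOf_le (h R hR)

/-- A hull set which is not everything has two vertices with a common outside neighbor. -/
theorem IsHullSet.exists_common_neighbor {R : Set V} (h : IsHullSet G R) (hR : R ≠ Set.univ) :
    ∃ x ∈ R, ∃ y ∈ R, x ≠ y ∧ ∃ z, G.Adj z x ∧ G.Adj z y := by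
  by_contra hc
  apply hR
  obtain ⟨t, ht⟩ := (isHullSet_iff G R).1 h
  suffices ∀ t, percSet G R t = R by rw [← ht, this]
  intro t
  induction t with
  | zero => rfl
  | succ t ih =>
    ext z
    rw [mem_percSet_succ, ih, or_iff_left]
    rintro ⟨x, hx, y, hy, hxy, h1, h2⟩
    exact hc ⟨x, hx, y, hy, hxy, z, h1, h2⟩

end Percolation

/-! ### Unit interval orders and last neighbors -/

section Reach

variable {V : Type*} {G : SimpleGraph V} {n : ℕ} {v : Fin n ≃ V} {r : ℕ → ℕ}

/-- `r` records the last neighbors with respect to the enumeration `v`: for `i < j`, the vertices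
`v i` and `v j` are adjacent if and only if `j ≤ r i`; moreover `r` is monotone and
`i + 2 ≤ r i` as long as `i + 2` is an index. -/
structure IsReach (G : SimpleGraph V) (v : Fin n ≃ V) (r : ℕ → ℕ) : Prop where
  mono : Monotone r
  lt : ∀ i, r i < n
  add_two_le : ∀ i, i + 2 < n → i + 2 ≤ r i
  adj_iff : ∀ i j : Fin n, i < j → (G.Adj (v i) (v j) ↔ (j : ℕ) ≤ r i)

theorem IsUnitIntervalOrder.adj_of_le (hv : IsUnitIntervalOrder G v) {a i j b : Fin n}
    (hai : a ≤ i) (hij : i < j) (hjb : j ≤ b) (hab : G.Adj (v a) (v b)) :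
    G.Adj (v i) (v j) := by
  have h1 : i = b ∨ G.Adj (v b) (v i) :=
    (hv b).out (Or.inr hab.symm) (Or.inl rfl) ⟨hai, hij.le.trans hjb⟩
  have h2 : G.Adj (v i) (v b) := by
    rcases h1 with rfl | h1
    · exact absurd hjb (not_le.2 hij)
    · exact h1.symm
  rcases (hv i).out (Or.inl rfl) (Or.inr h2) ⟨hij.le, hjb⟩ with h | h
  · exact absurd h hij.ne'
  · exact h

theorem IsUnitIntervalOrder.rev (hv : IsUnitIntervalOrder G v) :
    IsUnitIntervalOrder G (Fin.revPerm.trans v) := by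
  intro i
  refine ⟨fun a ha b hb c hc => ?_⟩
  have key : ∀ j : Fin n, (j = i ∨ G.Adj ((Fin.revPerm.trans v) i) ((Fin.revPerm.trans v) j)) ↔
      j.rev ∈ {j : Fin n | j = i.rev ∨ G.Adj (v i.rev) (v j)} := by
    intro j
    simp
  refine (key c).2 ((hv i.rev).out ((key b).1 hb) ((key a).1 ha) ?_)
  exact ⟨Fin.rev_le_rev.2 hc.2, Fin.rev_le_rev.2 hc.1⟩

/-- After deleting `v (i + 1)`, a walk from `v i` to `v (i + 2)` must use an edge jumping over the
gap; consecutiveness of neighborhoods shrinks that edge to the desired one. -/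
theorem IsTwoConnected.adj_add_two [Fintype V] (h2 : IsTwoConnected G)
    (hv : IsUnitIntervalOrder G v) {i k : Fin n} (hik : (k : ℕ) = i + 2) :
    G.Adj (v i) (v k) := by
  have hj : (i : ℕ) + 1 < n := by have := k.2; omega
  set j : Fin n := ⟨i + 1, hj⟩ with hjd
  have hij : i ≠ j := by simp [Fin.ext_iff, hjd]
  have hkj : k ≠ j := by simp [Fin.ext_iff, hjd, hik]
  let x : ↥({v j}ᶜ : Set V) := ⟨v i, by simpa using hij⟩
  let y : ↥({v j}ᶜ : Set V) := ⟨v k, by simpa using hkj⟩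
  obtain ⟨p⟩ := (h2.2.2 (v j)).preconnected x y
  obtain ⟨d, -, hd1, hd2⟩ := p.exists_boundary_dart {z | v.symm z.1 ≤ i} (by simp [x])
    (by simp only [Set.mem_ofPred_eq, y, Equiv.symm_apply_apply]; omega)
  have hadj : G.Adj (v (v.symm d.fst.1)) (v (v.symm d.snd.1)) := by
    simpa using d.adj
  simp only [Set.mem_ofPred_eq, not_le] at hd1 hd2
  have hne : v.symm d.snd.1 ≠ j := by
    intro h
    exact d.snd.2 (by simp [← h])
  refine hv.adj_of_le hd1 (by simp [Fin.lt_def, hik]) ?_ hadj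
  rw [Fin.lt_def] at hd2
  rw [Fin.le_def]
  have : (v.symm d.snd.1 : ℕ) ≠ i + 1 := fun h => hne (Fin.ext h)
  omega

theorem IsUnitIntervalOrder.exists_isReach [Fintype V] (hv : IsUnitIntervalOrder G v)
    (h2 : IsTwoConnected G) (hn : 0 < n) : ∃ r, IsReach G v r := by
  classical
  -- Collecting the neighbors of all `v k` with `k ≤ i` makes the supremum monotone by construction;
  -- `adj_of_le` shows that nothing spurious is added.
  let S : ℕ → Finset (Fin n) := fun i =>
    Finset.univ.filter fun j => ∃ k : Fin n, (k : ℕ) ≤ i ∧ G.Adj (v k) (v j)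
  have le_sup : ∀ {k j : Fin n} {i : ℕ}, (k : ℕ) ≤ i → G.Adj (v k) (v j) →
      (j : ℕ) ≤ (S i).sup (fun j => (j : ℕ)) := fun {k j i} hk h =>
    Finset.le_sup (f := fun j : Fin n => (j : ℕ)) (by simpa [S] using ⟨k, hk, h⟩)
  refine ⟨fun i => (S i).sup (fun j => (j : ℕ)), ?_, ?_, ?_, ?_⟩
  · intro i i' hii
    refine Finset.sup_mono fun j hj => ?_
    simp only [S, Finset.mem_filter, Finset.mem_univ, true_and] at hj ⊢
    obtain ⟨k, hk, h⟩ := hj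
    exact ⟨k, hk.trans hii, h⟩
  · intro i
    exact (Finset.sup_lt_iff (by simpa using hn)).2 fun j _ => j.2
  · intro i hi
    exact le_sup (k := ⟨i, by omega⟩) (j := ⟨i + 2, hi⟩) le_rfl (h2.adj_add_two hv rfl)
  · intro i j hij
    refine ⟨fun h => le_sup le_rfl h, fun h => ?_⟩
    rw [Fin.lt_def] at hij
    have h' := (Finset.le_sup_iff (show (⊥ : ℕ) < j by simp; omega)).1 h
    obtain ⟨b, hb, hjb⟩ := h'
    simp only [S, Finset.mem_filter, Finset.mem_univ, true_and] at hb
    obtain ⟨k, hk, hkb⟩ := hb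
    exact hv.adj_of_le hk hij hjb hkb

/-- The last index reached after `t` rounds from the first two vertices. -/
def front (r : ℕ → ℕ) : ℕ → ℕ
  | 0 => 1
  | t + 1 => r (front r t - 1)

/-! ### The front and its comparison with other percolations -/

namespace IsReach

theorem eq_or_adj (h : IsReach G v r) (i k : Fin n) (hik : (i : ℕ) < k → (k : ℕ) ≤ r i)
    (hki : (k : ℕ) < i → (i : ℕ) ≤ r k) : v i = v k ∨ G.Adj (v i) (v k) := by
  rcases lt_trichotomy i k with hlt | rfl | hlt
  · exact Or.inr ((h.adj_iff i k hlt).2 (hik hlt))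
  · exact Or.inl rfl
  · exact Or.inr ((h.adj_iff k i hlt).2 (hki hlt)).symm

theorem le_apply_sub_one (h : IsReach G v r) (hn : 3 ≤ n) {y : ℕ} (hy : y < n) :
    y ≤ r (y - 1) := by
  rcases Nat.lt_or_ge (y - 1 + 2) n with h1 | h1
  · have := h.add_two_le _ h1
    omega
  · have h2 := h.add_two_le (n - 3) (by omega)
    have h3 := h.mono (show n - 3 ≤ y - 1 by omega)
    omega

theorem front_lt (h : IsReach G v r) (hn : 3 ≤ n) (t : ℕ) : front r t < n := by
  cases t with
  | zero => simp only [front]; omega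
  | succ t => exact h.lt _

theorem one_le_front (h : IsReach G v r) (hn : 3 ≤ n) (t : ℕ) : 1 ≤ front r t := by
  cases t with
  | zero => exact le_rfl
  | succ t =>
    have h1 := h.add_two_le 0 (by omega)
    have h2 : r 0 ≤ r (front r t - 1) := h.mono (Nat.zero_le _)
    simp only [front]
    omega

theorem front_le_succ (h : IsReach G v r) (hn : 3 ≤ n) (t : ℕ) :
    front r t ≤ front r (t + 1) :=
  h.le_apply_sub_one hn (h.front_lt hn t)

theorem min_le_front (h : IsReach G v r) (hn : 3 ≤ n) (t : ℕ) :
    min (t + 1) (n - 1) ≤ front r t := by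
  induction t with
  | zero => simp [front]
  | succ t ih =>
    have h1 := h.front_le_succ hn t
    have h2 := h.one_le_front hn t
    rcases Nat.lt_or_ge (front r t - 1 + 2) n with h3 | h3
    · have h4 : front r t - 1 + 2 ≤ front r (t + 1) := h.add_two_le _ h3
      omega
    · omega

/-- Percolation from the first two vertices reaches initial segments. -/
theorem mem_percSet_iff_le_front [Finite V] (h : IsReach G v r) (hn : 3 ≤ n) {R : Set V}
    (hR : ∀ i : Fin n, v i ∈ R ↔ (i : ℕ) ≤ 1) (t : ℕ) (i : Fin n) :
    v i ∈ percSet G R t ↔ (i : ℕ) ≤ front r t := by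
  induction t generalizing i with
  | zero => exact hR i
  | succ t ih =>
    have h1 := h.front_le_succ hn t
    have h2 := h.one_le_front hn t
    have h3 := h.front_lt hn t
    constructor
    · rw [mem_percSet_succ, ih]
      rintro (hi | ⟨x, hx, y, hy, hxy, hix, hiy⟩)
      · exact hi.trans h1
      by_contra hc
      obtain ⟨a, rfl⟩ := v.surjective x
      obtain ⟨b, rfl⟩ := v.surjective y
      rw [ih] at hx hy
      have hab : a ≠ b := fun hab => hxy (by rw [hab])
      -- Infected vertices before the last one reach at most `r (front r t - 1)`, so a vertex beyond
      -- that sees at most one infected vertex.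
      have key : ∀ c : Fin n, (c : ℕ) ≤ front r t → G.Adj (v i) (v c) → ¬ (c : ℕ) < front r t := by
        intro c hc' hadj hlt
        have h4 := (h.adj_iff c i (by rw [Fin.lt_def]; omega)).1 hadj.symm
        have h5 : r c ≤ r (front r t - 1) := h.mono (by omega)
        exact hc (h4.trans h5)
      exact hab (Fin.ext (by have := key a hx hix; have := key b hy hiy; omega))
    · intro hi
      rcases Nat.lt_or_ge (front r t) i with hlt | hle
      · have hi' : (i : ℕ) ≤ r (front r t - 1) := hi
        have h5 : r (front r t - 1) ≤ r (front r t) := h.mono (by omega)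
        refine mem_percSet_succ_of_adj (x := v ⟨front r t - 1, by omega⟩)
          (y := v ⟨front r t, h3⟩) ((ih _).2 (Nat.sub_le _ _)) ((ih _).2 le_rfl) ?_
          (h.eq_or_adj _ _ ?_ ?_) (h.eq_or_adj _ _ ?_ ?_)
        · simp only [ne_eq, EmbeddingLike.apply_eq_iff_eq, Fin.mk.injEq]
          omega
        · simp only
          omega
        · exact fun _ => hi'
        · simp only
          omega
        · exact fun _ => hi'.trans h5
      · exact percSet_mono R (Nat.le_succ t) ((ih i).2 hle)

theorem percSet_eq_univ_iff [Finite V] (h : IsReach G v r) (hn : 3 ≤ n) {R : Set V}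
    (hR : ∀ i : Fin n, v i ∈ R ↔ (i : ℕ) ≤ 1) (t : ℕ) :
    percSet G R t = Set.univ ↔ front r t = n - 1 := by
  have h1 := h.front_lt hn t
  rw [Set.eq_univ_iff_forall]
  constructor
  · intro hu
    have := (h.mem_percSet_iff_le_front hn hR t ⟨n - 1, by omega⟩).1 (hu _)
    simp only at this
    omega
  · intro ht x
    obtain ⟨i, rfl⟩ := v.surjective x
    rw [h.mem_percSet_iff_le_front hn hR t i, ht]
    have := i.2
    omega

/-- Percolation from the last two vertices does not outrun the one from the first two. -/
theorem front_le_of_mem_percSet [Finite V] (h : IsReach G v r) (hn : 3 ≤ n) {R : Set V}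
    (hR : ∀ i : Fin n, v i ∈ R → n - 2 ≤ (i : ℕ)) {s : ℕ} (hs : front r s < n - 1)
    {k j : ℕ} (hkj : k + j = s) {i : Fin n} (hi : v i ∈ percSet G R k) : front r j ≤ i := by
  induction k generalizing i j with
  | zero =>
    obtain rfl : j = s := by omega
    have := hR i hi
    omega
  | succ k ih =>
    have ih' := fun {i} => ih (j := j + 1) (i := i) (by omega)
    have h1 := h.front_le_succ hn j
    rw [mem_percSet_succ] at hi
    rcases hi with hi | ⟨x, hx, y, hy, hxy, hix, hiy⟩
    · exact h1.trans (ih' hi)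
    by_contra hc
    obtain ⟨a, rfl⟩ := v.surjective x
    obtain ⟨b, rfl⟩ := v.surjective y
    have hab : a ≠ b := fun hab => hxy (by rw [hab])
    -- A vertex left of `front r j` has no neighbor beyond `front r (j + 1)`, where the infected
    -- vertices begin, so it sees at most one of them.
    have key : ∀ c : Fin n, front r (j + 1) ≤ c → G.Adj (v i) (v c) →
        (c : ℕ) ≤ front r (j + 1) := by
      intro c hc' hadj
      have h4 := (h.adj_iff i c (by rw [Fin.lt_def]; omega)).1 hadj
      have h5 : r i ≤ r (front r j - 1) := h.mono (by omega)
      exact h4.trans h5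
    have ha := ih' hx
    have hb := ih' hy
    exact hab (Fin.ext (by have := key a ha hix; have := key b hb hiy; omega))

/-- If the front were unfinished at time `t`, running it backwards would leave `v 0` uninfected
after `t` rounds from the right end. -/
theorem front_eq_of_percSet_eq_univ [Finite V] (h : IsReach G v r) (hn : 3 ≤ n) {R : Set V}
    (hR : ∀ i : Fin n, v i ∈ R → n - 2 ≤ (i : ℕ)) {t : ℕ} (ht : percSet G R t = Set.univ) :
    front r t = n - 1 := by
  by_contra hc
  have h1 := h.front_lt hn t
  have h2 := h.front_le_of_mem_percSet hn hR (s := t) (by omega) (Nat.add_zero t)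
    (i := ⟨0, by omega⟩) (ht ▸ Set.mem_univ _)
  simp [front] at h2

/-- An interval of infected vertices that is ahead of the front stays ahead of it. -/
theorem exists_interval [Finite V] (h : IsReach G v r) (hn : 3 ≤ n) {R : Set V} {a t : ℕ}
    (ht : ∃ y, a < y ∧ y < n ∧ front r t ≤ y ∧
      ∀ i : Fin n, a ≤ i → (i : ℕ) ≤ y → v i ∈ percSet G R t) {t' : ℕ} (htt : t ≤ t') :
    ∃ y, a < y ∧ y < n ∧ front r t' ≤ y ∧
      ∀ i : Fin n, a ≤ i → (i : ℕ) ≤ y → v i ∈ percSet G R t' := by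
  induction t', htt using Nat.le_induction with
  | base => exact ht
  | succ t' _ ih =>
    obtain ⟨y, hay, hyn, hfy, hy⟩ := ih
    have h1 := h.le_apply_sub_one hn hyn
    refine ⟨r (y - 1), hay.trans_le h1, h.lt _, h.mono (by omega), fun i hai hi => ?_⟩
    rcases Nat.lt_or_ge y i with hlt | hle
    · have h5 : r (y - 1) ≤ r y := h.mono (by omega)
      refine mem_percSet_succ_of_adj (x := v ⟨y - 1, by omega⟩) (y := v ⟨y, hyn⟩)
        (hy _ (by simp only; omega) (Nat.sub_le _ _)) (hy _ hay.le le_rfl) ?_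
        (h.eq_or_adj _ _ ?_ ?_) (h.eq_or_adj _ _ ?_ ?_)
      · simp only [ne_eq, EmbeddingLike.apply_eq_iff_eq, Fin.mk.injEq]
        omega
      · simp only
        omega
      · exact fun _ => hi
      · simp only
        omega
      · exact fun _ => hi.trans h5
    · exact percSet_mono R (Nat.le_succ t') (hy i hai hle)

/-- Once two vertices of `R` with a common neighbor are found, percolation from `R` to the right
takes no longer than percolation from the first two vertices. -/
theorem mem_percSet_of_le [Finite V] (h : IsReach G v r) (hn : 3 ≤ n) {R : Set V} {a b : Fin n}
    (hab : a < b) (ha : v a ∈ R) (hb : v b ∈ R) {z : V} (hza : G.Adj z (v a))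
    (hzb : G.Adj z (v b)) {T : ℕ} (hT : front r T = n - 1) {i : Fin n} (hai : a ≤ i) :
    v i ∈ percSet G R T := by
  have hlt := h.lt
  have hmono := h.mono
  rw [Fin.lt_def] at hab
  have hvab : v a ≠ v b := fun h => by
    rw [v.injective h] at hab
    exact lt_irrefl _ hab
  suffices ∃ t ≤ T, ∃ y, (a : ℕ) < y ∧ y < n ∧ front r t ≤ y ∧
      ∀ i : Fin n, (a : ℕ) ≤ i → (i : ℕ) ≤ y → v i ∈ percSet G R t by
    obtain ⟨t, htT, ht⟩ := this
    obtain ⟨y, -, -, h1, h2⟩ := h.exists_interval hn ht htT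
    exact h2 i hai (by have := i.2; omega)
  have hT1 : 1 ≤ T := by
    rcases Nat.eq_zero_or_pos T with rfl | hT1
    · simp only [front] at hT
      omega
    · exact hT1
  have hf1 : front r 1 ≤ r a := hmono (Nat.zero_le _)
  -- If `v a` and `v b` are adjacent, one round fills the interval from `a` to `r a`, and `front r 1
  -- = r 0 ≤ r a`.
  by_cases hra : (b : ℕ) ≤ r a
  · refine ⟨1, hT1, r a, hab.trans_le hra, hlt _, hf1, fun i hai hi => ?_⟩
    have h1 := hmono hai
    refine mem_percSet_succ_of_adj (t := 0) ha hb hvab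
      (h.eq_or_adj _ _ (by omega) (fun _ => hi))
      (h.eq_or_adj _ _ (fun _ => hra.trans h1) (fun _ => hi.trans (hmono hab.le)))
  obtain ⟨c, rfl⟩ := v.surjective z
  have hac : a < c := by
    by_contra hca
    have hca' : c < a := lt_of_le_of_ne (not_lt.1 hca) (by rintro rfl; exact hza.ne rfl)
    have h1 := (h.adj_iff c b (hca'.trans hab)).1 hzb
    exact hra (h1.trans (hmono hca'.le))
  have hcr : (c : ℕ) ≤ r a := (h.adj_iff a c hac).1 hza.symm
  have hcb : c < b := by
    rw [Fin.lt_def]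
    omega
  have hbc : (b : ℕ) ≤ r c := (h.adj_iff c b hcb).1 hzb
  rw [Fin.lt_def] at hac hcb
  -- Otherwise the common neighbor lies between them. The last neighbor `v d` of `v a` is then also
  -- adjacent to `v b`; it is infected in round one, and round two fills the interval from `a` to `r
  -- d`.
  set d : Fin n := ⟨r a, hlt _⟩ with hd
  have hdv : (d : ℕ) = r a := rfl
  have hbd : (b : ℕ) ≤ r d := hbc.trans (hmono hcr)
  have hdR : v d ∈ percSet G R 1 := by
    refine mem_percSet_succ_of_adj (t := 0) ha hb hvab
      (h.eq_or_adj _ _ (by omega) (fun _ => le_rfl)) (h.eq_or_adj _ _ (fun _ => hbd) (by omega))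
  have haR : v a ∈ percSet G R 1 := percSet_mono R (Nat.zero_le 1) ha
  have hbR : v b ∈ percSet G R 1 := percSet_mono R (Nat.zero_le 1) hb
  have hT2 : 2 ≤ T := by
    by_contra hT2
    obtain rfl : T = 1 := by omega
    have := b.2
    omega
  refine ⟨2, hT2, r d, by omega, hlt _,
    hmono ((Nat.sub_le _ _).trans hf1), fun i hai hi => ?_⟩
  rcases Nat.lt_or_ge d i with hlt' | hle
  · refine mem_percSet_succ_of_adj (t := 1) hdR hbR ?_
      (h.eq_or_adj _ _ (by omega) (fun _ => hi))
      (h.eq_or_adj _ _ (fun _ => hbd.trans (hmono hlt'.le)) (fun _ => hi.trans (hmono ?_)))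
    · rw [ne_eq, EmbeddingLike.apply_eq_iff_eq, Fin.ext_iff]
      omega
    · omega
  · refine mem_percSet_succ_of_adj (t := 1) haR hdR ?_
      (h.eq_or_adj _ _ (by omega) (fun _ => hle.trans hdv.le))
      (h.eq_or_adj _ _ (fun _ => hdv.le.trans (hmono hai)) (by omega))
    rw [ne_eq, EmbeddingLike.apply_eq_iff_eq, Fin.ext_iff]
    omega

end IsReach

/-- Percolation from the first two vertices of a unit interval order takes the longest. -/
theorem IsUnitIntervalOrder.percTimeOf_eq [Fintype V] (hv : IsUnitIntervalOrder G v)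
    (h2 : IsTwoConnected G) (hn : 3 ≤ n) :
    (IsHullSet G {v ⟨0, by omega⟩, v ⟨1, by omega⟩} ∧
      percTimeOf G {v ⟨0, by omega⟩, v ⟨1, by omega⟩} = percTime G) ∧
    (IsHullSet G {v ⟨n - 2, by omega⟩, v ⟨n - 1, by omega⟩} ∧
      percTimeOf G {v ⟨n - 2, by omega⟩, v ⟨n - 1, by omega⟩} = percTime G) := by
  obtain ⟨r, hr⟩ := hv.exists_isReach h2 (by omega)
  obtain ⟨q, hq⟩ := hv.rev.exists_isReach h2 (by omega)
  set R : Set V := {v ⟨0, by omega⟩, v ⟨1, by omega⟩} with hRdef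
  set L : Set V := {v ⟨n - 2, by omega⟩, v ⟨n - 1, by omega⟩} with hLdef
  have hR : ∀ i : Fin n, v i ∈ R ↔ (i : ℕ) ≤ 1 := by
    intro i
    simp only [hRdef, Set.mem_insert_iff, Set.mem_singleton_iff, EmbeddingLike.apply_eq_iff_eq,
      Fin.ext_iff]
    omega
  have hL : ∀ i : Fin n, v i ∈ L ↔ n - 2 ≤ (i : ℕ) := by
    intro i
    simp only [hLdef, Set.mem_insert_iff, Set.mem_singleton_iff, EmbeddingLike.apply_eq_iff_eq,
      Fin.ext_iff]
    have := i.2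
    omega
  have hR' : ∀ i : Fin n, (Fin.revPerm.trans v) i ∈ R ↔ n - 2 ≤ (i : ℕ) := by
    intro i
    rw [Equiv.trans_apply, hR, Fin.revPerm_apply, Fin.val_rev]
    omega
  have hL' : ∀ i : Fin n, (Fin.revPerm.trans v) i ∈ L ↔ (i : ℕ) ≤ 1 := by
    intro i
    rw [Equiv.trans_apply, hL, Fin.revPerm_apply, Fin.val_rev]
    omega
  have hRt := hr.percSet_eq_univ_iff hn hR
  have hLt := hq.percSet_eq_univ_iff hn hL'
  -- Each end pair is the last pair for the opposite order, so the comparison works in both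
  -- directions.
  have hRL : ∀ t, percSet G R t = Set.univ ↔ percSet G L t = Set.univ := fun t =>
    ⟨fun ht => (hLt t).2 (hq.front_eq_of_percSet_eq_univ hn (fun i => (hR' i).1) ht),
      fun ht => (hRt t).2 (hr.front_eq_of_percSet_eq_univ hn (fun i => (hL i).1) ht)⟩
  have hRhull : IsHullSet G R := by
    refine (isHullSet_iff G R).2 ⟨n, (hRt n).2 ?_⟩
    have h3 := hr.front_lt hn n
    have h4 := hr.min_le_front hn n
    omega
  have hLhull : IsHullSet G L := by
    obtain ⟨t, ht⟩ := (isHullSet_iff G R).1 hRhull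
    exact (isHullSet_iff G L).2 ⟨t, (hRL t).1 ht⟩
  have hTR := hRhull.percSet_percTimeOf
  have hmax : percTime G ≤ percTimeOf G R := by
    refine percTime_le fun S hS => ?_
    by_cases hSu : S = Set.univ
    · exact Set.eq_univ_of_univ_subset (hSu.symm.le.trans (percSet_mono S (Nat.zero_le _)))
    obtain ⟨x, hx, y, hy, hxy, z, hzx, hzy⟩ := hS.exists_common_neighbor hSu
    have key : ∀ a b : Fin n, a < b → v a ∈ S → v b ∈ S → G.Adj z (v a) → G.Adj z (v b) →
        percSet G S (percTimeOf G R) = Set.univ := by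
      intro a b hab ha hb hza hzb
      rw [Set.eq_univ_iff_forall]
      intro w
      obtain ⟨i, rfl⟩ := v.surjective w
      rcases le_total a i with hai | hia
      · exact hr.mem_percSet_of_le hn hab ha hb hza hzb ((hRt _).1 hTR) hai
      · have := hq.mem_percSet_of_le hn (R := S) (a := b.rev) (b := a.rev) (z := z) (i := i.rev)
          (Fin.rev_lt_rev.2 hab) (by simpa using hb) (by simpa using ha) (by simpa using hzb)
          (by simpa using hza) ((hLt _).1 ((hRL _).1 hTR))
          (Fin.rev_le_rev.2 (hia.trans hab.le))
        simpa using this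
    obtain ⟨a, rfl⟩ := v.surjective x
    obtain ⟨b, rfl⟩ := v.surjective y
    rcases lt_trichotomy a b with hab | rfl | hab
    · exact key a b hab hx hy hzx hzy
    · exact absurd rfl hxy
    · exact key b a hab hy hx hzy hzx
  have hRtime : percTimeOf G R = percTime G := (percTimeOf_le_percTime hRhull).antisymm hmax
  have hLR : percTimeOf G L = percTimeOf G R := by
    simp only [percTimeOf, hRL]
  exact ⟨⟨hRhull, hRtime⟩, hLhull, hLR.trans hRtime⟩

end Reach

/-- Some vertex has two neighbors, so its complement is a hull set needing one round. The bound
matters because `doubledPath 0` has only two vertices. -/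
theorem IsTwoConnected.one_le_percTime {V : Type*} [Fintype V] {G : SimpleGraph V}
    (h2 : IsTwoConnected G) : 1 ≤ percTime G := by
  have : Nontrivial V := Fintype.one_lt_card_iff_nontrivial.1 (by have := h2.1; omega)
  obtain ⟨x⟩ := this.to_nonempty
  obtain ⟨y, hxy⟩ := h2.2.1.preconnected.exists_adj_of_nontrivial x
  obtain ⟨w, hwx, hwy⟩ : ∃ w, w ≠ x ∧ w ≠ y := by
    classical
    obtain ⟨w, -, hw⟩ := Finset.exists_mem_notMem_of_card_lt_card
      (s := ({x, y} : Finset V)) (t := Finset.univ)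
      (Finset.card_le_two.trans_lt (by rw [Finset.card_univ]; exact h2.1))
    exact ⟨w, by simpa [not_or] using hw⟩
  let x' : ↥({y}ᶜ : Set V) := ⟨x, hxy.ne⟩
  let w' : ↥({y}ᶜ : Set V) := ⟨w, hwy⟩
  have : Nontrivial ↥({y}ᶜ : Set V) := ⟨w', x', fun h => hwx (congrArg Subtype.val h)⟩
  obtain ⟨⟨z, hzy⟩, hxz⟩ := (h2.2.2 y).preconnected.exists_adj_of_nontrivial x'
  replace hxz : G.Adj x z := hxz
  have hull : IsHullSet G ({x}ᶜ : Set V) := by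
    refine (isHullSet_iff G _).2 ⟨1, Set.eq_univ_of_forall fun u => mem_percSet_succ.2 ?_⟩
    by_cases hu : u = x
    · subst hu
      exact Or.inr ⟨y, hxy.ne', z, hxz.ne', fun h => hzy h.symm, hxy, hxz⟩
    · exact Or.inl hu
  refine le_trans ?_ (percTimeOf_le_percTime hull)
  rw [Nat.one_le_iff_ne_zero]
  intro h0
  have h1 := hull.percSet_percTimeOf
  rw [h0] at h1
  have hx : x ∈ percSet G ({x}ᶜ : Set V) 0 := h1 ▸ Set.mem_univ x
  exact hx rfl

/-! ### The doubled path as `G*` -/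

/-- The strong product of a path with `T + 1` vertices and an edge, as a graph on
`{0, …, 2 * T + 1}`: the `i`-th vertex of the path is replaced by `2 * i` and `2 * i + 1`. -/
def doubledPath (T : ℕ) : SimpleGraph (Fin (2 * T + 2)) where
  Adj i j := i ≠ j ∧ (i : ℕ) / 2 ≤ j / 2 + 1 ∧ (j : ℕ) / 2 ≤ i / 2 + 1
  symm := ⟨fun _ _ h => ⟨h.1.symm, h.2.2, h.2.1⟩⟩
  loopless := ⟨fun _ h => h.1 rfl⟩

namespace doubledPath

variable {T : ℕ}

theorem adj_iff {i j : Fin (2 * T + 2)} : (doubledPath T).Adj i j ↔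
    (i : ℕ) ≠ j ∧ (i : ℕ) / 2 ≤ j / 2 + 1 ∧ (j : ℕ) / 2 ≤ i / 2 + 1 := by
  rw [ne_eq, ← Fin.ext_iff]
  rfl

theorem isUnitIntervalGraph : IsUnitIntervalGraph (doubledPath T) := by
  -- In units of `1/30`, offsets within neighboring pairs are at most `23`, those between pairs two
  -- apart at least `37`; the shift `3` separates twins.
  let g : Fin (2 * T + 2) → ℤ := fun i => 20 * ((i : ℕ) / 2 : ℕ) + 3 * ((i : ℕ) % 2 : ℕ)
  refine ⟨fun i => (g i : ℝ) / 30, fun i j hij => ?_, fun i j hij => ?_⟩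
  · have h1 : (g i : ℝ) = g j := by
      simp only at hij
      linarith
    have h2 : g i = g j := by exact_mod_cast h1
    simp only [g] at h2
    apply Fin.ext
    omega
  · rw [Set.Icc_inter_Icc, Set.nonempty_Icc, sup_le_iff, le_inf_iff, le_inf_iff, adj_iff]
    have key : ∀ a b : ℤ, (a : ℝ) / 30 ≤ (b : ℝ) / 30 + 1 ↔ a ≤ b + 30 := by
      intro a b
      rw [← Int.cast_le (R := ℝ)]
      push_cast
      constructor <;> intro h <;> linarith
    have hself : ∀ a : ℤ, a ≤ a + 30 := fun a => by omega
    simp only [key, hself, true_and, and_true]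
    rw [ne_eq, Fin.ext_iff] at hij
    simp only [g]
    omega

theorem isUnitIntervalOrder :
    IsUnitIntervalOrder (doubledPath T) (Equiv.refl (Fin (2 * T + 2))) := by
  refine fun i => ⟨fun a ha b hb c hc => ?_⟩
  simp only [Equiv.refl_apply, Set.mem_ofPred_eq, adj_iff, Fin.ext_iff, Set.mem_Icc,
    Fin.le_def] at ha hb hc ⊢
  omega

theorem maximalCliquesShareTwo : MaximalCliquesShareTwo (doubledPath T) := by
  rintro C D hC hD - ⟨x, hxC, hxD⟩
  obtain ⟨y, hxy, hy⟩ : ∃ y, (doubledPath T).Adj x y ∧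
      ∀ z, z ≠ y → (doubledPath T).Adj x z → (doubledPath T).Adj y z := by
    have := x.2
    -- The twin of `x`, the other member of its pair, belongs to every maximal clique through `x`.
    refine ⟨⟨4 * (x / 2) + 1 - x, by omega⟩, ?_, fun z hzy hxz => ?_⟩
    · rw [adj_iff]
      simp only
      omega
    · rw [adj_iff] at *
      rw [ne_eq, Fin.ext_iff] at hzy
      simp only at *
      omega
  have key : ∀ E, Maximal (doubledPath T).IsClique E → x ∈ E → y ∈ E := by
    intro E hE hxE
    refine hE.2 (y := insert y E) ?_ (Set.subset_insert y E) (Set.mem_insert y E)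
    refine SimpleGraph.isClique_insert.2 ⟨hE.1, fun z hz hyz => ?_⟩
    by_cases hzx : x = z
    · exact hzx ▸ hxy.symm
    · exact hy z hyz.symm (hE.1 hxE hz hzx)
  exact (Set.one_lt_ncard_iff (Set.toFinite _)).2
    ⟨x, y, ⟨hxC, hxD⟩, ⟨key C hC hxC, key D hD hxD⟩, hxy.ne⟩

/-- The bound starts at `1`, since twins have equal path position but distance one. -/
theorem exists_walk_length_le (k : ℕ) (i j : Fin (2 * T + 2)) (hij : (i : ℕ) / 2 ≤ j / 2)
    (hk : (j : ℕ) / 2 ≤ i / 2 + (k + 1)) : ∃ p : (doubledPath T).Walk i j, p.length ≤ k + 1 := by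
  induction k generalizing j with
  | zero =>
    by_cases h : i = j
    · subst h
      exact ⟨.nil, by simp⟩
    · refine ⟨.cons (v := j) (adj_iff.2 ⟨by simpa [Fin.ext_iff] using h, ?_, ?_⟩) .nil, by simp⟩
        <;> omega
  | succ k ih =>
    by_cases h : (j : ℕ) / 2 ≤ i / 2 + (k + 1)
    · obtain ⟨p, hp⟩ := ih j hij h
      exact ⟨p, by omega⟩
    · obtain ⟨p, hp⟩ := ih ⟨j - 2, by omega⟩ (by simp only; omega) (by simp only; omega)
      refine ⟨p.concat (adj_iff.2 ⟨?_, ?_, ?_⟩), by rw [SimpleGraph.Walk.length_concat]; omega⟩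
        <;> simp only <;> omega

theorem div_two_le_add_length {i j : Fin (2 * T + 2)} (p : (doubledPath T).Walk i j) :
    (j : ℕ) / 2 ≤ i / 2 + p.length := by
  induction p with
  | nil => simp
  | cons h p ih =>
    have := (adj_iff.1 h).2.2
    rw [SimpleGraph.Walk.length_cons]
    omega

theorem diam_eq (hT : 1 ≤ T) : (doubledPath T).diam = T := by
  have hle : ∀ i j : Fin (2 * T + 2), (i : ℕ) / 2 ≤ j / 2 → (doubledPath T).edist i j ≤ T := by
    intro i j hij
    have := j.2
    obtain ⟨p, hp⟩ := exists_walk_length_le (T - 1) i j hij (by omega)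
    exact (SimpleGraph.Walk.edist_le p).trans (by exact_mod_cast (by omega : p.length ≤ T))
  have hed : (doubledPath T).ediam ≤ T := by
    refine SimpleGraph.ediam_le_of_edist_le fun i j => ?_
    rcases le_total ((i : ℕ) / 2) (j / 2) with h | h
    · exact hle i j h
    · rw [SimpleGraph.edist_comm]
      exact hle j i h
  have hge : (T : ℕ∞) ≤ (doubledPath T).ediam := by
    refine le_trans ?_ (SimpleGraph.edist_le_ediam (u := ⟨0, by omega⟩) (v := ⟨2 * T, by omega⟩))
    refine le_iInf fun p => ?_
    have := div_two_le_add_length p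
    simp only at this
    exact_mod_cast (by omega : T ≤ p.length)
  rw [SimpleGraph.diam, hed.antisymm hge, ENat.toNat_natCast]

theorem isTwoConnected (hT : 1 ≤ T) : IsTwoConnected (doubledPath T) := by
  refine ⟨by rw [Fintype.card_fin]; omega, ?_, fun x => ?_⟩
  · rw [SimpleGraph.connected_iff_diam_ne_zero, diam_eq hT]
    omega
  -- `b` is the least surviving vertex; every other survivor `i` is adjacent to `i - 1` or, if that
  -- was deleted, to `i - 2`.
  obtain ⟨b, hbx, hb⟩ : ∃ b : Fin (2 * T + 2), b ≠ x ∧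
      ∀ i : Fin (2 * T + 2), i ≠ x → i ≠ b → b < i ∧ ((i : ℕ) - 1 = x → 2 ≤ (i : ℕ)) := by
    simp only [ne_eq, Fin.ext_iff, Fin.lt_def]
    by_cases hx : (x : ℕ) = 0
    · exact ⟨⟨1, by omega⟩, by simp only; omega, fun i => by simp only; omega⟩
    · exact ⟨⟨0, by omega⟩, by simp only; omega, fun i => by simp only; omega⟩
  have reach : ∀ (k : ℕ) (i : Fin (2 * T + 2)) (hi : i ≠ x), (i : ℕ) = k →
      ((doubledPath T).induce ({x}ᶜ : Set _)).Reachable ⟨b, hbx⟩ ⟨i, hi⟩ := by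
    intro k
    induction k using Nat.strong_induction_on with
    | _ k ih =>
      intro i hi hik
      by_cases hib : i = b
      · subst hib
        rfl
      obtain ⟨h1, h2⟩ := hb i hi hib
      rw [Fin.lt_def] at h1
      obtain ⟨p, hpx, hpi, hadj⟩ : ∃ p, p ≠ x ∧ (p : ℕ) < i ∧ (doubledPath T).Adj p i := by
        simp only [adj_iff, ne_eq, Fin.ext_iff]
        by_cases h3 : (i : ℕ) - 1 = x
        · exact ⟨⟨i - 2, by omega⟩, by simp only; omega⟩
        · exact ⟨⟨i - 1, by omega⟩, by simp only; omega⟩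
      have hadj' : ((doubledPath T).induce ({x}ᶜ : Set _)).Adj ⟨p, hpx⟩ ⟨i, hi⟩ := hadj
      exact (ih p (by omega) p hpx rfl).trans hadj'.reachable
  have : Nonempty ↥({x}ᶜ : Set (Fin (2 * T + 2))) := ⟨⟨b, hbx⟩⟩
  exact ⟨fun i j => (reach _ i.1 i.2 rfl).symm.trans (reach _ j.1 j.2 rfl)⟩

theorem isReach : IsReach (doubledPath T) (Equiv.refl (Fin (2 * T + 2)))
    (fun i => min (2 * (i / 2) + 3) (2 * T + 1)) where
  mono i j hij := by
    simp only
    omega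
  lt i := by omega
  add_two_le i hi := by omega
  adj_iff i j hij := by
    rw [Fin.lt_def] at hij
    have := j.2
    simp only [Equiv.refl_apply, adj_iff]
    omega

theorem percTime_eq (hT : 1 ≤ T) : percTime (doubledPath T) = T := by
  obtain ⟨⟨-, hRT⟩, -⟩ := isUnitIntervalOrder.percTimeOf_eq (isTwoConnected hT)
    (n := 2 * T + 2) (by omega)
  -- The front always ends at a complete pair and advances by exactly one pair per round.
  have hfront : ∀ t, front (fun i => min (2 * (i / 2) + 3) (2 * T + 1)) t =
      min (2 * t + 1) (2 * T + 1) := by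
    intro t
    induction t with
    | zero => simp [front]
    | succ t ih =>
      simp only [front, ih]
      omega
  have hset : ∀ t, percSet (doubledPath T) {Equiv.refl (Fin (2 * T + 2)) ⟨0, by omega⟩,
      Equiv.refl (Fin (2 * T + 2)) ⟨1, by omega⟩} t = Set.univ ↔ T ≤ t := by
    intro t
    rw [isReach.percSet_eq_univ_iff (by omega), hfront]
    · omega
    · intro i
      simp only [Equiv.refl_apply, Set.mem_insert_iff, Set.mem_singleton_iff, Fin.ext_iff]
      omega
  rw [← hRT, percTimeOf]
  simp only [hset]
  exact csInf_Ici

end doubledPath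
end P3Perc

theorem mainTheorem6 {V : Type*} [Fintype V] (G : SimpleGraph V)
    (h3 : 3 ≤ Fintype.card V) (h2 : P3Perc.IsTwoConnected G)
    (hG : P3Perc.IsUnitIntervalGraph G) :
    (∃ (m : ℕ) (Gstar : SimpleGraph (Fin m)),
        P3Perc.IsTwoConnected Gstar ∧ P3Perc.IsUnitIntervalGraph Gstar ∧
        P3Perc.MaximalCliquesShareTwo Gstar ∧
        P3Perc.percTime G = P3Perc.percTime Gstar ∧
        P3Perc.percTime Gstar = Gstar.diam) ∧
    (∀ v : Fin (Fintype.card V) ≃ V, P3Perc.IsUnitIntervalOrder G v →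
        (P3Perc.IsHullSet G {v ⟨0, by omega⟩, v ⟨1, by omega⟩} ∧
          P3Perc.percTimeOf G {v ⟨0, by omega⟩, v ⟨1, by omega⟩} = P3Perc.percTime G) ∧
        (P3Perc.IsHullSet G
            {v ⟨Fintype.card V - 2, by omega⟩, v ⟨Fintype.card V - 1, by omega⟩} ∧
          P3Perc.percTimeOf G
            {v ⟨Fintype.card V - 2, by omega⟩, v ⟨Fintype.card V - 1, by omega⟩} =
              P3Perc.percTime G)) := by
  have hT := h2.one_le_percTime
  refine ⟨⟨_, P3Perc.doubledPath (P3Perc.percTime G), P3Perc.doubledPath.isTwoConnected hT,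
    P3Perc.doubledPath.isUnitIntervalGraph, P3Perc.doubledPath.maximalCliquesShareTwo,
    (P3Perc.doubledPath.percTime_eq hT).symm, ?_⟩, fun v hv => hv.percTimeOf_eq h2 h3⟩
  rw [P3Perc.doubledPath.percTime_eq hT, P3Perc.doubledPath.diam_eq hT]
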